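/- Write $\deg\alpha=[\mathbb{Q}(\alpha):\mathbb{Q}]$ and let $h$ be the absolute logarithmic Weil height on $\overline{\mathbb{Q}}$. For $\gamma\in\mathbb{R}$ put $h_\gamma(\alpha)=(\deg\alpha)^\gamma h(\alpha)$. For $f:\overline{\mathbb{Q}}\to[0,\infty)$ and $S\subset\overline{\mathbb{Q}}$ let $$\mathcal{N}_f(S)=\inf\{t\in[0,\infty):\ \#\{\alpha\in S: f(\alpha)<t\}=\infty\}\in[0,\infty],\qquad \inf\emptyset=\infty.$$ Let $\mu\subset\overline{\mathbb{Q}}$ be the set of roots of unity. A set $S\subset\overline{\mathbb{Q}}$ is called $\gamma$-Northcott if $\mathcal{N}_{h_\gamma}(S)=\infty$, and $\gamma$-Bogomolov if $\mathcal{N}_{h_\gamma}(S\setminus\mu)>0$. **Theorem.** Let $0\le\gamma\le 1$ and $\varepsilon>0$. Let $(d_i)_{i\in\mathbb{N}}$ and $(p_i)_{i\in\mathbb{N}}$ be sequences of primes such that, for all $i\in\mathbb{N}$, $d_{i+1}\ge 2d_i$ and $$d_i^{\,1-\gamma+\varepsilon/2}\le\log p_i\le\log 2+d_i^{\,1-\gamma+\varepsilon/2}.$$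 For each $i$ let $p_i^{1/d_i}\in\overline{\mathbb{Q}}$ be any choice of a $d_i$-th root of $p_i$. Then the field $\mathbb{Q}(p_i^{1/d_i};\, i\in\mathbb{N})$ is $\gamma$-Northcott but not $(\gamma-\varepsilon)$-Bogomolov. -/

import Mathlib

open scoped NNReal ENNReal IntermediateField

noncomputable section

namespace NorthcottNumbers

/-- The field of algebraic numbers. -/
abbrev QBar : Type := AlgebraicClosure ℚ

/-- The Northcott number of a set `S` of algebraic numbers with respect to
`f : QBar → [0, ∞)`: the infimum in `[0, ∞]` of all `t ∈ [0, ∞)` such that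
`{α ∈ S | f α < t}` is infinite; it is `∞` if there is no such `t`. -/
def northcottNumber (f : QBar → ℝ≥0) (S : Set QBar) : ℝ≥0∞ :=
  sInf ((fun t : ℝ≥0 => (t : ℝ≥0∞)) '' {t : ℝ≥0 | {α : QBar | α ∈ S ∧ f α < t}.Infinite})

/-- The degree `[ℚ(α) : ℚ]` of an algebraic number. -/
def degree (α : QBar) : ℕ := Module.finrank ℚ ℚ⟮α⟯

/-- The absolute logarithmic Weil height is nonnegative. -/
theorem absLogHeight_nonneg (α : QBar) : 0 ≤ NumberField.absLogHeight₁ α := by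
  unfold NumberField.absLogHeight₁ NumberField.absMulHeight₁
  split_ifs with h
  · haveI : FiniteDimensional ℚ ℚ⟮α⟯ := IntermediateField.adjoin.finiteDimensional h
    haveI : NumberField ℚ⟮α⟯ := {}
    exact Real.log_nonneg (Real.one_le_rpow (Height.one_le_mulHeight₁ _) (by positivity))
  · simp

/-- The normalised height `h_γ(α) = (deg α)^γ h(α)`, where `h` is the absolute logarithmic
Weil height. -/
def weightedHeight (γ : ℝ) (α : QBar) : ℝ≥0 :=
  ⟨(degree α : ℝ) ^ γ * NumberField.absLogHeight₁ α,
    mul_nonneg (Real.rpow_nonneg (Nat.cast_nonneg _) _) (absLogHeight_nonneg α)⟩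

/-- The set of all roots of unity in `QBar`. -/
def rootsOfUnitySet : Set QBar := {ζ | ∃ n : ℕ, 0 < n ∧ ζ ^ n = 1}

/-- `S` is `γ`-Northcott: its Northcott number with respect to `h_γ` is infinite. -/
def IsGammaNorthcott (γ : ℝ) (S : Set QBar) : Prop :=
  northcottNumber (weightedHeight γ) S = ∞

/-- `S` is `γ`-Bogomolov: the Northcott number of `S` without the roots of unity,
with respect to `h_γ`, is positive. -/
def IsGammaBogomolov (γ : ℝ) (S : Set QBar) : Prop :=
  0 < northcottNumber (weightedHeight γ) (S \ rootsOfUnitySet)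

end NorthcottNumbers

end

/-! Let F be generated by the first i radicals, and put E = F(θ) with θ^d = p, d = d_i, p = p_i. As
d is prime, any α in E outside F generates E over F, so deg α ≥ d. Its height is bounded below by
squeezing the discriminant of E. Silverman's inequality (`abs_discr_le_mulHeight₁_pow`) gives |disc
E| ≤ H(α)^(2(d-1)) |disc F|^d d^(d[F:ℚ]), with H the height relative to E. If p is unramified in F,
total ramification (`pow_mul_natAbs_discr_pow_le`) gives |disc E| ≥ p^([F:ℚ](d-1)) |disc F|^d. Hence
h(α) ≥ log p/(2d) - log d/(2(d-1)).

Primes ramified in F are among the earlier d_j and p_j (`prime_dvd_discr_layer`); growth makes p_i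
differ from all of them for large i. Multiplied by d^γ, the bound is at least d^(ε/2)/2 - log d,
which tends to infinity. So elements of bounded h_γ all lie in one fixed layer, where Northcott's
theorem applies.

Conversely, θ_i has degree d_i and height log p_i/d_i, so h_(γ-ε)(θ_i) tends to 0 along infinitely
many elements that are not roots of unity. -/

namespace NorthcottNumbers

open NumberField Module

/-! ### Hadamard's determinant inequality -/

section Hadamard

open scoped ComplexOrder

/-- **Hadamard's inequality** in squared form: if the rows of a complex square matrix have squared
Euclidean norms bounded by `C i`, its determinant has squared modulus at most `∏ i, C i`. -/
theorem norm_det_sq_le_prod {n : Type*} [Fintype n] [DecidableEq n] (A : Matrix n n ℂ) (C : n → ℝ)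
    (hC : ∀ i, 0 < C i) (hA : ∀ i, ∑ j, ‖A i j‖ ^ 2 ≤ C i) : ‖A.det‖ ^ 2 ≤ ∏ i, C i := by
  rcases isEmpty_or_nonempty n with hn | hn
  · simp
  -- With rows rescaled to norm at most 1, the Gram matrix has trace at most n; AM–GM on its
  -- eigenvalues bounds its determinant by 1.
  let s : n → ℝ := fun i => √(C i)
  have hs (i) : 0 < s i := Real.sqrt_pos.2 (hC i)
  let A' : Matrix n n ℂ := Matrix.of fun i j => ((s i)⁻¹ : ℂ) * A i j
  have hdet' : A'.det = (∏ i, ((s i)⁻¹ : ℂ)) * A.det := Matrix.det_mul_column _ _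
  have hrow (i) : ∑ j, ‖A' i j‖ ^ 2 ≤ 1 := by
    have : ∑ j, ‖A' i j‖ ^ 2 = (C i)⁻¹ * ∑ j, ‖A i j‖ ^ 2 := by
      rw [Finset.mul_sum]
      refine Finset.sum_congr rfl fun j _ => ?_
      simp only [A', Matrix.of_apply, norm_mul, norm_inv, Complex.norm_real, mul_pow, inv_pow,
        Real.norm_eq_abs, sq_abs, s, Real.sq_sqrt (hC i).le]
    rw [this, inv_mul_le_iff₀ (hC i), mul_one]
    exact hA i
  have hP : (A' * A'.conjTranspose).PosSemidef := Matrix.posSemidef_self_mul_conjTranspose A'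
  have hH := hP.isHermitian
  have htr : ∑ i, hH.eigenvalues i ≤ Fintype.card n := by
    have h1 := hH.trace_eq_sum_eigenvalues
    have h2 : (A' * A'.conjTranspose).trace = ((∑ i, ∑ j, ‖A' i j‖ ^ 2 : ℝ) : ℂ) := by
      simp only [Matrix.trace, Matrix.diag, Matrix.mul_apply, Matrix.conjTranspose_apply,
        RCLike.star_def, Complex.mul_conj, Complex.normSq_eq_norm_sq]
      push_cast
      rfl
    have h3 : ((∑ i, ∑ j, ‖A' i j‖ ^ 2 : ℝ) : ℂ) = ((∑ i, hH.eigenvalues i : ℝ) : ℂ) := by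
      rw [← h2, h1]; push_cast; rfl
    rw [← Complex.ofReal_injective h3]
    calc ∑ i, ∑ j, ‖A' i j‖ ^ 2 ≤ ∑ i : n, (1 : ℝ) := Finset.sum_le_sum fun i _ => hrow i
      _ = Fintype.card n := by simp
  have hdet : ‖A'.det‖ ^ 2 = ∏ i, hH.eigenvalues i := by
    have h1 := hH.det_eq_prod_eigenvalues
    rw [Matrix.det_mul, Matrix.det_conjTranspose, RCLike.star_def, Complex.mul_conj,
      Complex.normSq_eq_norm_sq] at h1
    exact Complex.ofReal_injective (h1.trans (by push_cast; rfl))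
  have hcard : (0 : ℝ) < Fintype.card n := by exact_mod_cast Fintype.card_pos
  have hle : ∏ i, hH.eigenvalues i ≤ 1 := by
    have h := Real.geom_mean_le_arith_mean Finset.univ (fun _ => (1 : ℝ)) hH.eigenvalues
      (fun _ _ => zero_le_one) (by simpa using hcard) (fun i _ => hP.eigenvalues_nonneg i)
    simp only [Real.rpow_one, Finset.sum_const, Finset.card_univ, nsmul_eq_mul, mul_one,
      one_mul] at h
    have h' : (∏ i, hH.eigenvalues i) ^ ((Fintype.card n : ℝ)⁻¹) ≤ 1 :=
      h.trans ((div_le_one hcard).2 htr)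
    by_contra! hcon
    exact absurd h' (not_le.2 (Real.one_lt_rpow hcon (by positivity)))
  rw [← hdet, hdet', norm_mul, mul_pow, norm_prod, ← Finset.prod_pow] at hle
  have hCs : ∏ i, ‖((s i)⁻¹ : ℂ)‖ ^ 2 = (∏ i, C i)⁻¹ := by
    rw [← Finset.prod_inv_distrib]
    refine Finset.prod_congr rfl fun i _ => ?_
    simp only [norm_inv, Complex.norm_real, inv_pow, Real.norm_eq_abs, sq_abs, s,
      Real.sq_sqrt (hC i).le]
  rwa [hCs, inv_mul_le_iff₀ (Finset.prod_pos fun i _ => hC i), mul_one] at hle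

end Hadamard

/-! ### Ideal norms and embedding determinants -/

section Lattice

variable {K : Type*} [Field K] [NumberField K]

/-- The coordinate matrix factors through a ℤ-basis of `I`, whose own determinant is the norm of `I`
up to sign. -/
theorem absNorm_dvd_natAbs_det {S ι : Type*} [CommRing S] [IsDedekindDomain S] [Module.Free ℤ S]
    [Module.Finite ℤ S] [CharZero S] [Fintype ι] [DecidableEq ι] (b : Basis ι ℤ S) (I : Ideal S)
    (hI : I ≠ ⊥) (x : ι → S) (hx : ∀ i, x i ∈ I) : I.absNorm ∣ (b.det x).natAbs := by
  let bI : Basis ι ℤ I := I.selfBasis b hI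
  have key : b.toMatrix x =
      b.toMatrix ((↑) ∘ bI) * bI.toMatrix fun i => (⟨x i, hx i⟩ : I) := by
    ext i j
    have h : x j = ∑ k, bI.repr ⟨x j, hx j⟩ k • (bI k : S) := by
      conv_lhs => rw [show x j = ((⟨x j, hx j⟩ : I) : S) from rfl, ← bI.sum_repr ⟨x j, hx j⟩]
      rw [AddSubmonoidClass.coe_finsetSum]
      rfl
    simp only [Matrix.mul_apply, Basis.toMatrix_apply, Function.comp]
    conv_lhs => rw [h]
    rw [map_sum, Finsupp.finsetSum_apply]
    refine Finset.sum_congr rfl fun k _ => ?_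
    rw [map_smul, Finsupp.smul_apply, smul_eq_mul, mul_comm]
  rw [Basis.det_apply, key, Matrix.det_mul, Int.natAbs_mul, ← Basis.det_apply,
    Ideal.natAbs_det_basis_change]
  exact dvd_mul_right _ _

/-- Elements of an ideal `I` with nonzero embedding determinant span a sublattice of `I`. -/
theorem absNorm_sq_mul_discr_le {ι : Type*} [Fintype ι] [DecidableEq ι]
    (e : ι ≃ (K →ₐ[ℚ] ℂ)) (I : Ideal (𝓞 K)) (hI : I ≠ ⊥) (x : ι → 𝓞 K) (hx : ∀ i, x i ∈ I)
    (hdet : (Matrix.of fun i j => e j (x i : K)).det ≠ 0) :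
    (I.absNorm : ℝ) ^ 2 * |(discr K : ℝ)| ≤ ‖(Matrix.of fun i j => e j (x i : K)).det‖ ^ 2 := by
  classical
  have hcard : Fintype.card (Free.ChooseBasisIndex ℤ (𝓞 K)) = Fintype.card ι := by
    rw [← Module.finrank_eq_card_chooseBasisIndex, RingOfIntegers.rank, Fintype.card_congr e,
      AlgHom.card]
  let b : Basis ι ℤ (𝓞 K) := (RingOfIntegers.basis K).reindex (Fintype.equivOfCardEq hcard)
  have h1 : Algebra.discr ℤ x = (b.det x) ^ 2 * discr K := by
    rw [← discr_eq_discr K b, Basis.det_apply, ← Algebra.discr_of_matrix_vecMul,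
      Basis.toMatrix_map_vecMul]
  have h2 : Algebra.discr ℚ (fun i => (x i : K)) = ((Algebra.discr ℤ x : ℤ) : ℚ) := by
    rw [Algebra.discr_def, Algebra.discr_def, ← eq_intCast (algebraMap ℤ ℚ), RingHom.map_det]
    congr 1
    ext i j
    simp only [Algebra.traceMatrix_apply, Algebra.traceForm_apply, RingHom.mapMatrix_apply,
      Matrix.map_apply]
    rw [eq_intCast, ← map_mul, Algebra.coe_trace_int]
  have h3 := Algebra.discr_eq_det_embeddingsMatrixReindex_pow_two ℚ ℂ (fun i => (x i : K)) e
  have h4 : Algebra.embeddingsMatrixReindex ℚ ℂ (fun i => (x i : K)) e =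
      Matrix.of fun i j => e j (x i : K) := by
    ext i j; rfl
  rw [h4, h2, h1] at h3
  have h5 := congrArg norm h3
  rw [norm_pow] at h5
  rw [← h5]
  have hne : b.det x ≠ 0 := by
    intro h0
    rw [h0] at h3
    exact hdet (by simpa using h3.symm)
  have h6 : (I.absNorm : ℝ) ≤ |(b.det x : ℝ)| := by
    rw [← Int.cast_abs, Int.abs_eq_natAbs]
    exact_mod_cast Nat.le_of_dvd (Int.natAbs_pos.2 hne) (absNorm_dvd_natAbs_det b I hI x hx)
  have h7 : ‖(algebraMap ℚ ℂ) (((b.det x) ^ 2 * discr K : ℤ) : ℚ)‖ =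
      |(b.det x : ℝ)| ^ 2 * |(discr K : ℝ)| := by
    rw [eq_ratCast]
    push_cast
    rw [norm_mul, norm_pow, Complex.norm_intCast, Complex.norm_intCast]
  rw [h7]
  gcongr

end Lattice

/-! ### Heights under field extension -/

section Height

open Height

variable {K : Type*} [Field K] [NumberField K]

/-- The archimedean part of the height of `(a : b)`, as a product over all complex embeddings. -/
noncomputable def archHeight (a b : K) : ℝ := ∏ φ : K →ₐ[ℚ] ℂ, max ‖φ a‖ ‖φ b‖

theorem prod_infinitePlace_max_eq_archHeight (a b : K) :
    ∏ v : InfinitePlace K, max (v a) (v b) ^ v.mult = archHeight a b := by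
  classical
  rw [archHeight, ← Fintype.prod_equiv (RingHom.equivRatAlgHom K ℂ)
    (fun f => max ‖f a‖ ‖f b‖) (fun φ => max ‖φ a‖ ‖φ b‖)
    fun _ => by simp [RingHom.equivRatAlgHom_apply]]
  rw [← Finset.prod_fiberwise Finset.univ InfinitePlace.mk (fun φ => max ‖φ a‖ ‖φ b‖)]
  have (w : InfinitePlace K) (φ) (hφ : φ ∈ ({φ | InfinitePlace.mk φ = w} : Finset _)) :
      max ‖φ a‖ ‖φ b‖ = max (w a) (w b) := by
    rw [← (Finset.mem_filter.mp hφ).2, InfinitePlace.apply, InfinitePlace.apply]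
  simp_rw [Finset.prod_congr rfl (this _), Finset.prod_const, InfinitePlace.card_filter_mk_eq]

theorem max_norm_algHom_pos {a b : K} (hb : b ≠ 0) (φ : K →ₐ[ℚ] ℂ) : 0 < max ‖φ a‖ ‖φ b‖ :=
  lt_max_of_lt_right (norm_pos_iff.2 ((map_ne_zero φ).2 hb))

/-- The finite places contribute exactly the inverse norm of the ideal (a, b), so multiplying by
that norm leaves the archimedean part. -/
theorem mulHeight₁_div_mul_absNorm (a b : 𝓞 K) (hb : b ≠ 0) :
    mulHeight₁ ((a : K) / (b : K)) * (Ideal.span {a, b}).absNorm =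
      archHeight (a : K) (b : K) := by
  have hx : ![a, b] ≠ 0 := fun h => hb (by simpa using congrFun h 1)
  have hx' : ![(a : K), (b : K)] ≠ 0 := fun h => hb (by simpa using congrFun h 1)
  have h := absNorm_mul_finprod_finitePlace_eq_one hx
  rw [mulHeight₁_div_eq_mulHeight, NumberField.mulHeight_eq hx',
    ← prod_infinitePlace_max_eq_archHeight]
  have hsup (f : Fin 2 → ℝ) : ⨆ i, f i = max (f 0) (f 1) := by
    refine le_antisymm (ciSup_le fun i => ?_) (max_le ?_ ?_)
    · fin_cases i <;> simp
    · exact le_ciSup (Set.finite_range f).bddAbove 0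
    · exact le_ciSup (Set.finite_range f).bddAbove 1
  simp only [Matrix.range_cons, Matrix.range_empty, Set.union_empty, Set.singleton_union, hsup,
    Matrix.cons_val_zero, Matrix.cons_val_one] at h ⊢
  rw [mul_assoc, mul_comm (∏ᶠ _, _), h, mul_one]

/-- Each complex embedding of `L` has [K : L] extensions to `K`. -/
theorem archHeight_algebraMap {L : Type*} [Field L] [NumberField L] [Algebra L K] (a b : L) :
    archHeight (algebraMap L K a) (algebraMap L K b) = archHeight a b ^ finrank L K := by
  classical
  have : FiniteDimensional L K := FiniteDimensional.right ℚ L K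
  have : Algebra.IsSeparable L K := Algebra.isSeparable_tower_top_of_isSeparable ℚ L K
  rw [archHeight, archHeight, Fintype.prod_equiv algHomEquivSigma
    (fun σ : K →ₐ[ℚ] ℂ => _) (fun σ => max ‖σ.1 a‖ ‖σ.1 b‖),
    ← Finset.univ_sigma_univ, Finset.prod_sigma, ← Finset.prod_pow]
  · refine Finset.prod_congr rfl fun σ _ => ?_
    let : Algebra L ℂ := σ.toRingHom.toAlgebra
    simp_rw [Finset.prod_const]
    congr
    exact AlgHom.card L K ℂ
  · intro σ
    simp only [algHomEquivSigma, Equiv.coe_fn_mk, AlgHom.domRestrict, AlgHom.comp_apply,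
      IsScalarTower.coe_toAlgHom']

theorem exists_integers_div (x : K) : ∃ a b : 𝓞 K, b ≠ 0 ∧ x = (a : K) / (b : K) := by
  obtain ⟨a, b, hb, h⟩ := IsFractionRing.div_surjective (A := 𝓞 K) x
  exact ⟨a, b, nonZeroDivisors.ne_zero hb, h.symm⟩

/-- For x = a/b, the archimedean part and the norm of (a, b) are both raised to the power [K : L],
hence so is their quotient. -/
theorem mulHeight₁_algebraMap {L : Type*} [Field L] [NumberField L] [Algebra L K] (x : L) :
    mulHeight₁ (algebraMap L K x) = mulHeight₁ x ^ finrank L K := by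
  obtain ⟨a, b, hb, rfl⟩ := exists_integers_div x
  have : FiniteDimensional L K := FiniteDimensional.right ℚ L K
  have hb' : algebraMap (𝓞 L) (𝓞 K) b ≠ 0 :=
    (map_ne_zero_iff _ (FaithfulSMul.algebraMap_injective _ _)).2 hb
  have h1 := mulHeight₁_div_mul_absNorm a b hb
  have h2 := mulHeight₁_div_mul_absNorm (algebraMap (𝓞 L) (𝓞 K) a) (algebraMap (𝓞 L) (𝓞 K) b) hb'
  have hmap : Ideal.span {algebraMap (𝓞 L) (𝓞 K) a, algebraMap (𝓞 L) (𝓞 K) b} =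
      (Ideal.span {a, b}).map (algebraMap (𝓞 L) (𝓞 K)) := by
    rw [Ideal.map_span, Set.image_pair]
  have hfin : finrank (𝓞 L) (𝓞 K) = finrank L K :=
    (IsFractionRing.finrank_eq (𝓞 L) L (𝓞 K) K).symm
  rw [hmap, Ideal.absNorm_algebraMap, hfin] at h2
  have hcoe (y : 𝓞 L) : ((algebraMap (𝓞 L) (𝓞 K) y : 𝓞 K) : K) = algebraMap L K (y : L) := rfl
  rw [hcoe, hcoe, archHeight_algebraMap, ← h1, mul_pow, ← map_div₀, Nat.cast_pow] at h2
  refine mul_right_cancel₀ (pow_ne_zero _ ?_) h2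
  rw [Nat.cast_ne_zero, Ne, Ideal.absNorm_eq_zero_iff]
  intro h0
  exact hb (by simpa using (Ideal.span_eq_bot.1 h0) b (by simp))

theorem logHeight₁_algebraMap {L : Type*} [Field L] [NumberField L] [Algebra L K] (x : L) :
    logHeight₁ (algebraMap L K x) = finrank L K * logHeight₁ x := by
  rw [logHeight₁, logHeight₁, mulHeight₁_algebraMap, Real.log_pow]

theorem absLogHeight₁_eq {Ω : Type*} [Field Ω] [CharZero Ω] (F : IntermediateField ℚ Ω)
    [NumberField F] (x : F) :
    absLogHeight₁ (x : Ω) = logHeight₁ x / finrank ℚ F := by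
  have hx : IsIntegral ℚ (x : Ω) := (Algebra.IsIntegral.isIntegral (R := ℚ) x).map F.val
  have : FiniteDimensional ℚ ℚ⟮(x : Ω)⟯ := IntermediateField.adjoin.finiteDimensional hx
  have : NumberField ℚ⟮(x : Ω)⟯ := {}
  have hle : ℚ⟮(x : Ω)⟯ ≤ F := by
    rw [IntermediateField.adjoin_simple_le_iff]; exact x.2
  let : Algebra ℚ⟮(x : Ω)⟯ F := (IntermediateField.inclusion hle).toRingHom.toAlgebra
  have hmap : algebraMap ℚ⟮(x : Ω)⟯ F (IntermediateField.AdjoinSimple.gen ℚ (x : Ω)) = x := by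
    ext; rfl
  have : FiniteDimensional ℚ⟮(x : Ω)⟯ F := FiniteDimensional.right ℚ ℚ⟮(x : Ω)⟯ F
  have h1 : logHeight₁ x = finrank ℚ⟮(x : Ω)⟯ F *
      logHeight₁ (IntermediateField.AdjoinSimple.gen ℚ (x : Ω)) := by
    rw [← logHeight₁_algebraMap, hmap]
  have h2 : finrank ℚ ℚ⟮(x : Ω)⟯ * finrank ℚ⟮(x : Ω)⟯ F = finrank ℚ F := finrank_mul_finrank _ _ _
  have h3 : (finrank ℚ⟮(x : Ω)⟯ F : ℝ) ≠ 0 := by exact_mod_cast finrank_pos.ne'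
  have h4 : (finrank ℚ ℚ⟮(x : Ω)⟯ : ℝ) ≠ 0 := by exact_mod_cast finrank_pos.ne'
  rw [h1, ← h2, absLogHeight₁, absMulHeight₁, dif_pos hx, Real.log_rpow (mulHeight₁_pos _),
    logHeight₁]
  push_cast
  field_simp

end Height

/-! ### Silverman's inequality -/

section Silverman

open Height
open scoped Kronecker

variable {F E : Type*} [Field F] [NumberField F] [Field E] [NumberField E] [Algebra F E]

theorem norm_det_embeddings_integralBasis_sq {κ : Type*} [Fintype κ] [DecidableEq κ]
    (ω : Basis κ ℤ (𝓞 F)) (e : κ ≃ (F →ₐ[ℚ] ℂ)) :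
    ‖(Matrix.of fun k l => e l (ω k : F)).det‖ ^ 2 = |(discr F : ℝ)| := by
  have h2 : Algebra.discr ℚ (fun i => (ω i : F)) = ((Algebra.discr ℤ ω : ℤ) : ℚ) := by
    rw [Algebra.discr_def, Algebra.discr_def, ← eq_intCast (algebraMap ℤ ℚ), RingHom.map_det]
    congr 1
    ext i j
    simp only [Algebra.traceMatrix_apply, Algebra.traceForm_apply, RingHom.mapMatrix_apply,
      Matrix.map_apply]
    rw [eq_intCast, ← map_mul, Algebra.coe_trace_int]
  have h3 := Algebra.discr_eq_det_embeddingsMatrixReindex_pow_two ℚ ℂ (fun i => (ω i : F)) e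
  have h4 : Algebra.embeddingsMatrixReindex ℚ ℂ (fun i => (ω i : F)) e =
      Matrix.of fun k l => e l (ω k : F) := by
    ext i j; rfl
  rw [h4, h2, discr_eq_discr] at h3
  rw [← norm_pow, ← h3, eq_ratCast, Rat.cast_intCast, Complex.norm_intCast]

/-- The block matrix of homogenised Vandermonde rows attached to the complex embeddings of `E`,
blocked by their restrictions to `F`. -/
noncomputable def blockVandermonde {κ ι : Type*} [DecidableEq κ] (d : ℕ) (eF : κ ≃ (F →ₐ[ℚ] ℂ))
    (e : ι ≃ (E →ₐ[ℚ] ℂ)) (a b : E) : Matrix ι (κ × Fin d) ℂ :=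
  Matrix.of fun i q => if eF.symm ((e i).comp (IsScalarTower.toAlgHom ℚ F E)) = q.1 then
    e i a ^ (q.2 : ℕ) * e i b ^ (d - 1 - (q.2 : ℕ)) else 0

theorem sum_norm_blockVandermonde_sq_le {κ ι : Type*} [Fintype κ] [DecidableEq κ] (d : ℕ)
    (eF : κ ≃ (F →ₐ[ℚ] ℂ)) (e : ι ≃ (E →ₐ[ℚ] ℂ)) (a b : E) (i : ι) :
    ∑ q, ‖blockVandermonde d eF e a b i q‖ ^ 2 ≤
      d * max ‖e i a‖ ‖e i b‖ ^ (2 * (d - 1)) := by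
  rw [Fintype.sum_prod_type, Finset.sum_eq_single
    (eF.symm ((e i).comp (IsScalarTower.toAlgHom ℚ F E)))]
  · calc _ ≤ ∑ _j : Fin d, max ‖e i a‖ ‖e i b‖ ^ (2 * (d - 1)) := by
          refine Finset.sum_le_sum fun j _ => ?_
          have hj : (j : ℕ) + (d - 1 - j) = d - 1 := by omega
          simp only [blockVandermonde, Matrix.of_apply, if_true, norm_mul, norm_pow]
          rw [mul_comm 2, pow_mul]
          refine pow_le_pow_left₀ (by positivity) ?_ 2
          conv_rhs => rw [← hj, pow_add]
          gcongr
          · exact le_max_left _ _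
          · exact le_max_right _ _
      _ = _ := by simp
  · intro k _ hk
    refine Finset.sum_eq_zero fun j _ => ?_
    simp [blockVandermonde, hk.symm]
  · simp

/-- An embedding of `E` acts on ω through its restriction to `F`. This separates the discriminant of
`F` from a factor depending only on `a` and `b`. -/
theorem embeddings_matrix_eq_kronecker_mul {κ ι : Type*} [Fintype κ] [DecidableEq κ] (d : ℕ)
    (eF : κ ≃ (F →ₐ[ℚ] ℂ)) (e : ι ≃ (E →ₐ[ℚ] ℂ)) (ω : κ → F) (a b : E) :
    (Matrix.of fun (q : κ × Fin d) i =>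
        e i (algebraMap F E (ω q.1) * (a ^ (q.2 : ℕ) * b ^ (d - 1 - (q.2 : ℕ))))) =
      ((Matrix.of fun k l => eF l (ω k)) ⊗ₖ (1 : Matrix (Fin d) (Fin d) ℂ)) *
        (blockVandermonde d eF e a b).transpose := by
  ext ⟨k, j⟩ i
  rw [Matrix.mul_apply, Fintype.sum_prod_type, Finset.sum_eq_single
    (eF.symm ((e i).comp (IsScalarTower.toAlgHom ℚ F E))), Finset.sum_eq_single j]
  · simp [blockVandermonde]
  · intro j' _ hj'
    simp [Matrix.one_apply_ne hj'.symm]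
  · simp
  · intro l _ hl
    refine Finset.sum_eq_zero fun j' _ => ?_
    simp [blockVandermonde, hl.symm]
  · simp

/-- **Silverman's inequality**: the relative discriminant bounds the height of a generator from
below. -/
theorem abs_discr_le_mulHeight₁_pow (pb : PowerBasis F E) :
    |(discr E : ℝ)| ≤ mulHeight₁ pb.gen ^ (2 * (pb.dim - 1)) *
      (|(discr F : ℝ)| ^ pb.dim * (pb.dim : ℝ) ^ (pb.dim * finrank ℚ F)) := by
  classical
  have : FiniteDimensional F E := FiniteDimensional.right ℚ F E
  obtain ⟨a, b, hb, hab⟩ := exists_integers_div pb.gen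
  set d := pb.dim with hd
  have hd0 : 0 < d := pb.dim_pos
  have hfin : finrank F E = d := pb.finrank
  have hbE : (b : E) ≠ 0 := RingOfIntegers.coe_ne_zero_iff.2 hb
  set J : Ideal (𝓞 E) := Ideal.span {a, b} with hJ
  have hJ0 : J ≠ ⊥ := fun h0 => hb (by simpa using (Ideal.span_eq_bot.1 h0) b (by simp))
  have hJpos : (0 : ℝ) < J.absNorm := by
    rw [Nat.cast_pos, Nat.pos_iff_ne_zero, Ne, Ideal.absNorm_eq_zero_iff]; exact hJ0
  let κ := Free.ChooseBasisIndex ℤ (𝓞 F)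
  let ω : Basis κ ℤ (𝓞 F) := RingOfIntegers.basis F
  have hκ : Fintype.card κ = finrank ℚ F := by
    rw [← Module.finrank_eq_card_chooseBasisIndex, RingOfIntegers.rank]
  let eF : κ ≃ (F →ₐ[ℚ] ℂ) := Fintype.equivOfCardEq (by rw [hκ, AlgHom.card])
  have hι : Fintype.card (κ × Fin d) = d * finrank ℚ F := by
    rw [Fintype.card_prod, hκ, Fintype.card_fin, mul_comm]
  let e : κ × Fin d ≃ (E →ₐ[ℚ] ℂ) := Fintype.equivOfCardEq (by
    rw [hι, AlgHom.card, ← finrank_mul_finrank ℚ F E, hfin, mul_comm])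
  -- Homogenised powers replace those of a/b: they are integral and lie in `J ^ (d - 1)`, whose norm
  -- later cancels against the archimedean height.
  let x : κ × Fin d → 𝓞 E := fun q =>
    algebraMap (𝓞 F) (𝓞 E) (ω q.1) * (a ^ (q.2 : ℕ) * b ^ (d - 1 - (q.2 : ℕ)))
  have hx (q) : x q ∈ J ^ (d - 1) := by
    refine Ideal.mul_mem_left _ _ ?_
    have hq : (q.2 : ℕ) + (d - 1 - q.2) = d - 1 := by omega
    rw [← hq, pow_add, hq]
    exact Ideal.mul_mem_mul (Ideal.pow_mem_pow (Ideal.subset_span (by simp)) _)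
      (Ideal.pow_mem_pow (Ideal.subset_span (by simp)) _)
  have hxE (q) : (x q : E) = algebraMap F E (ω q.1 : F) *
      ((a : E) ^ (q.2 : ℕ) * (b : E) ^ (d - 1 - (q.2 : ℕ))) := by
    simp only [x, map_mul, map_pow]
    rfl
  have hM : (Matrix.of fun q i => e i (x q : E)) =
      ((Matrix.of fun k l => eF l (ω k : F)) ⊗ₖ (1 : Matrix (Fin d) (Fin d) ℂ)) *
        (blockVandermonde d eF e (a : E) (b : E)).transpose := by
    rw [← embeddings_matrix_eq_kronecker_mul]
    ext q i
    rw [Matrix.of_apply, Matrix.of_apply, hxE]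
  have hdet : (Matrix.of fun q i => e i (x q : E)).det ≠ 0 := by
    -- Up to the factor b^(d-1), `x` is the product of an integral basis of `F` and the power basis
    -- of a/b, hence a ℚ-basis.
    let B : Basis (κ × Fin d) ℚ E := ((integralBasis F).smulTower pb.basis).map
      ((LinearEquiv.smulOfNeZero E E ((b : E) ^ (d - 1)) (pow_ne_zero _ hbE)).restrictScalars ℚ)
    have hB (q) : B q = (x q : E) := by
      have hq : d - 1 = (q.2 : ℕ) + (d - 1 - q.2) := by omega
      have : B q = (b : E) ^ (d - 1) • ((integralBasis F q.1) • (pb.basis q.2)) := by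
        simp only [B, Basis.map_apply, Basis.smulTower_apply]
        rfl
      have hω : integralBasis F q.1 = (ω q.1 : F) := integralBasis_apply F q.1
      rw [this, hxE, PowerBasis.coe_basis, hω, Algebra.smul_def (ω q.1 : F), smul_eq_mul]
      simp only [hab, div_pow]
      conv_lhs => rw [hq, pow_add]
      field_simp
    have h1 := Algebra.discr_not_zero_of_basis ℚ B
    have h2 := Algebra.discr_eq_det_embeddingsMatrixReindex_pow_two ℚ ℂ B e
    have h4 : Algebra.embeddingsMatrixReindex ℚ ℂ B e =
        Matrix.of fun q i => e i (x q : E) := by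
      ext i j
      rw [Matrix.of_apply, ← hB]; rfl
    rw [h4] at h2
    intro h0
    rw [h0] at h2
    exact h1 (by simpa using h2)
  have hlow := absNorm_sq_mul_discr_le e (J ^ (d - 1)) (pow_ne_zero _ hJ0) x hx hdet
  have hup : ‖(Matrix.of fun q i => e i (x q : E)).det‖ ^ 2 ≤ |(discr F : ℝ)| ^ d *
      ((d : ℝ) ^ (d * finrank ℚ F) * archHeight (a : E) (b : E) ^ (2 * (d - 1))) := by
    -- The Kronecker factor yields |disc F|^d; Hadamard bounds the Vandermonde factor.
    rw [hM, Matrix.det_mul, Matrix.det_kronecker, Matrix.det_transpose, Matrix.det_one, one_pow,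
      mul_one, Fintype.card_fin, norm_mul, mul_pow, norm_pow, pow_right_comm,
      norm_det_embeddings_integralBasis_sq ω eF]
    gcongr
    refine (norm_det_sq_le_prod _ (fun i => d * max ‖e i a‖ ‖e i b‖ ^ (2 * (d - 1))) (fun i => ?_)
      (sum_norm_blockVandermonde_sq_le d eF e (a : E) (b : E))).trans_eq ?_
    · have := max_norm_algHom_pos (a := (a : E)) hbE (e i)
      positivity
    · rw [Finset.prod_mul_distrib, Finset.prod_const, Finset.card_univ, hι, Finset.prod_pow,
        archHeight, e.prod_comp (fun φ : E →ₐ[ℚ] ℂ => max ‖φ (a : E)‖ ‖φ (b : E)‖)]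
  have hH := mulHeight₁_div_mul_absNorm a b hb
  rw [← hab] at hH
  rw [← hH, mul_pow] at hup
  have h := hlow.trans hup
  rw [map_pow, Nat.cast_pow, ← pow_mul, mul_comm (d - 1) 2] at h
  have hpos : 0 < (J.absNorm : ℝ) ^ (2 * (d - 1)) := by positivity
  refine le_of_mul_le_mul_left (h.trans_eq ?_) hpos
  ring

end Silverman

/-! ### Ramification and relative differents -/

section Discriminant

open Polynomial

variable {F E : Type*} [Field F] [NumberField F] [Field E] [NumberField E] [Algebra F E]

theorem absNorm_span_natCast (n : ℕ) :
    (Ideal.span {(n : 𝓞 E)}).absNorm = n ^ finrank ℚ E := by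
  rw [Ideal.absNorm_span_singleton, ← RingOfIntegers.rank E]
  have : (n : 𝓞 E) = algebraMap ℤ (𝓞 E) n := by simp
  rw [this, Algebra.norm_algebraMap, Int.natAbs_pow, Int.natAbs_natCast]

/-- If `p` is unramified in `F`, adjoining a `d`-th root of `p` multiplies the discriminant by at
least the contribution of a totally ramified prime. -/
theorem pow_mul_natAbs_discr_pow_le {p d : ℕ} (hp : p.Prime) (hd : d ≠ 0) (θ : 𝓞 E)
    (hθ : θ ^ d = (p : 𝓞 E)) (hfin : finrank F E = d) (hpF : ¬ (p : ℤ) ∣ discr F) :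
    p ^ (finrank ℚ F * (d - 1)) * (discr F).natAbs ^ d ≤ (discr E).natAbs := by
  have : FiniteDimensional F E := FiniteDimensional.right ℚ F E
  have hpZ : Prime (p : ℤ) := Nat.prime_iff_prime_int.1 hp
  have hmax : (Ideal.span {(p : ℤ)}).IsMaximal :=
    PrincipalIdealRing.isMaximal_of_irreducible hpZ.irreducible
  have hspan : Ideal.span {θ} ^ d = (Ideal.span {(p : ℤ)}).map (algebraMap ℤ (𝓞 E)) := by
    rw [Ideal.span_singleton_pow, hθ, Ideal.map_span, Set.image_singleton]
    simp
  -- Since (θ)^d = (p), the absolute different absorbs (θ)^(d-1); coprimality with the different of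
  -- `F` then moves this factor into the relative different.
  have h1 : Ideal.span {θ} ^ (d - 1) ∣ differentIdeal ℤ (𝓞 E) :=
    pow_sub_one_dvd_differentIdeal ℤ (Ideal.span {θ}) d (by simpa using hp.ne_zero) hspan.dvd
  have hmul := differentIdeal_eq_differentIdeal_mul_differentIdeal ℤ (𝓞 F) (𝓞 E)
  have hcop : IsCoprime (Ideal.span {θ})
      ((differentIdeal ℤ (𝓞 F)).map (algebraMap (𝓞 F) (𝓞 E))) := by
    obtain ⟨u, v, huv⟩ := (hpZ.coprime_iff_not_dvd (n := discr F)).2 hpF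
    rw [Ideal.isCoprime_iff_exists]
    refine ⟨u * p, ?_, v * discr F, ?_, ?_⟩
    · rw [← hθ, Ideal.mem_span_singleton]
      exact (dvd_pow_self _ hd).mul_left _
    · refine Ideal.mul_mem_left _ _ ?_
      rw [← map_intCast (algebraMap (𝓞 F) (𝓞 E))]
      exact Ideal.mem_map_of_mem _ (discr_mem_differentIdeal _ _)
    · have := congrArg (Int.cast : ℤ → 𝓞 E) huv
      push_cast at this
      exact this
  have h2 : Ideal.span {θ} ^ (d - 1) ∣ differentIdeal (𝓞 F) (𝓞 E) := by
    rw [hmul] at h1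
    exact (IsCoprime.pow_left hcop).dvd_of_dvd_mul_right h1
  have hdisc := natAbs_discr_eq_absNorm_differentIdeal_mul_natAbs_discr_pow F (𝓞 F) E (𝓞 E)
  have hnorm : (Ideal.span {θ}).absNorm = p ^ finrank ℚ F := by
    refine Nat.pow_left_injective hd ?_
    simp only
    rw [← map_pow, Ideal.span_singleton_pow, hθ, absNorm_span_natCast, ← pow_mul,
      ← finrank_mul_finrank ℚ F E, hfin]
  have h3 := map_dvd Ideal.absNorm h2
  rw [map_pow, hnorm, ← pow_mul] at h3
  rw [hdisc, hfin]
  refine Nat.mul_le_mul_right _ (Nat.le_of_dvd (Nat.pos_of_ne_zero fun h0 => ?_) h3)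
  rw [h0, zero_mul, Int.natAbs_eq_zero] at hdisc
  exact discr_ne_zero E hdisc

/-- A prime ramified in `F(θ)`, where `θ ^ d = m`, is ramified in `F` or divides `d * m`. -/
theorem prime_dvd_discr_adjoin_root {m d q : ℕ} (hq : q.Prime) (hd : d ≠ 0) (θ : 𝓞 E)
    (hgen : F⟮(θ : E)⟯ = ⊤) (hmin : minpoly F (θ : E) = X ^ d - C (m : F))
    (hqE : (q : ℤ) ∣ discr E) : (q : ℤ) ∣ discr F ∨ q ∣ d ∨ q ∣ m := by
  have : FiniteDimensional F E := FiniteDimensional.right ℚ F E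
  have hint : IsIntegral (𝓞 F) θ := Algebra.IsIntegral.isIntegral θ
  have hminO : minpoly (𝓞 F) θ = X ^ d - C (m : 𝓞 F) := by
    refine Polynomial.map_injective (algebraMap (𝓞 F) F) (FaithfulSMul.algebraMap_injective _ _) ?_
    rw [← minpoly.isIntegrallyClosed_eq_field_fractions F E hint, hmin]
    simp
  have hadj : Algebra.adjoin F {algebraMap (𝓞 E) E θ} = ⊤ :=
    (IntermediateField.adjoin_simple_eq_top_iff_of_isAlgebraic
      (Algebra.IsAlgebraic.isAlgebraic (θ : E))).1 hgen
  have hmem := aeval_derivative_mem_differentIdeal (𝓞 F) F E θ hadj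
  have hroot : θ ^ d = (m : 𝓞 E) := by
    have h := minpoly.aeval (𝓞 F) θ
    rw [hminO] at h
    simpa [sub_eq_zero] using h
  -- For f = X^d - m, the different contains f'(θ), hence also θ f'(θ) = d θ^d = d m.
  have hdm : ((d * m : ℕ) : 𝓞 E) ∈ differentIdeal (𝓞 F) (𝓞 E) := by
    have h := Ideal.mul_mem_left _ θ hmem
    rw [hminO] at h
    have h' : θ * (aeval θ) (derivative (X ^ d - C (m : 𝓞 F))) = ((d * m : ℕ) : 𝓞 E) := by
      rw [derivative_sub, derivative_X_pow, derivative_C, sub_zero, map_mul, map_pow, aeval_X,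
        aeval_C, map_natCast]
      rw [mul_left_comm, ← pow_succ', Nat.sub_add_cancel (Nat.pos_of_ne_zero hd), hroot]
      push_cast
      rfl
    rwa [h'] at h
  have hdvd : (differentIdeal (𝓞 F) (𝓞 E)).absNorm ∣ (d * m) ^ finrank ℚ E := by
    rw [← absNorm_span_natCast]
    exact Ideal.absNorm_dvd_absNorm_of_le ((Ideal.span_singleton_le_iff_mem _).2 hdm)
  have hdisc := natAbs_discr_eq_absNorm_differentIdeal_mul_natAbs_discr_pow F (𝓞 F) E (𝓞 E)
  have hqE' : q ∣ (discr E).natAbs := Int.natCast_dvd.1 hqE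
  rw [hdisc, hq.dvd_mul] at hqE'
  rcases hqE' with h | h
  · exact .inr (hq.dvd_mul.1 (hq.dvd_of_dvd_pow (h.trans hdvd)))
  · exact .inl (Int.natCast_dvd.2 (hq.dvd_of_dvd_pow h))

end Discriminant

/-! ### Height bound in a prime-degree extension -/

section PrimeDegree

open Height Polynomial

variable {F E : Type*} [Field F] [NumberField F] [Field E] [NumberField E] [Algebra F E]

theorem adjoin_simple_eq_top_of_finrank_prime {d : ℕ} (hd : d.Prime) (hfin : finrank F E = d)
    {α : E} (hα : α ∉ Set.range (algebraMap F E)) : F⟮α⟯ = ⊤ := by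
  have : FiniteDimensional F E := FiniteDimensional.right ℚ F E
  have := IntermediateField.isSimpleOrder_of_finrank_prime F E (hfin ▸ hd)
  refine (eq_bot_or_eq_top F⟮α⟯).resolve_left fun h => hα ?_
  rwa [IntermediateField.adjoin_simple_eq_bot_iff, IntermediateField.mem_bot] at h

theorem finrank_eq_of_minpoly {m d : ℕ} {θ : E} (hgen : F⟮θ⟯ = ⊤)
    (hmin : minpoly F θ = X ^ d - C (m : F)) : finrank F E = d := by
  have : FiniteDimensional F E := FiniteDimensional.right ℚ F E
  have h := IntermediateField.adjoin.finrank (Algebra.IsIntegral.isIntegral (R := F) θ)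
  rwa [hgen, IntermediateField.finrank_top', hmin, natDegree_X_pow_sub_C] at h

theorem finrank_rat_eq_mul {d : ℕ} (h : finrank F E = d) : finrank ℚ E = finrank ℚ F * d := by
  rw [← h, finrank_mul_finrank]

theorem exists_powerBasis_gen_eq {α : E} (hgen : F⟮α⟯ = ⊤) :
    ∃ pb : PowerBasis F E, pb.gen = α ∧ pb.dim = finrank F E := by
  have : FiniteDimensional F E := FiniteDimensional.right ℚ F E
  let pb := (IntermediateField.adjoin.powerBasis
    (Algebra.IsIntegral.isIntegral (R := F) α)).map
    ((IntermediateField.equivOfEq hgen).trans IntermediateField.topEquiv)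
  exact ⟨pb, rfl, pb.finrank.symm⟩

/-- Lower bound for the height of an element generating an extension of prime degree `d` obtained by
adjoining a `d`-th root of a prime that is unramified in the base. -/
theorem le_logHeight₁_div_finrank {p d : ℕ} (hp : p.Prime) (hd : d.Prime) {θ : E}
    (hθ : θ ^ d = (p : E)) (hfin : finrank F E = d) (hpF : ¬ (p : ℤ) ∣ discr F)
    {α : E} (hα : α ∉ Set.range (algebraMap F E)) :
    Real.log p / (2 * d) - Real.log d / (2 * (d - 1)) ≤ logHeight₁ α / finrank ℚ E := by
  obtain ⟨pb, rfl, hdim⟩ :=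
    exists_powerBasis_gen_eq (adjoin_simple_eq_top_of_finrank_prime hd hfin hα)
  rw [hfin] at hdim
  have hθint : IsIntegral ℤ θ := by
    refine IsIntegral.of_pow hd.pos ?_
    rw [hθ]
    simpa using isIntegral_algebraMap (R := ℤ) (A := E) (x := (p : ℤ))
  obtain ⟨θ, rfl⟩ : ∃ t : 𝓞 E, (t : E) = θ := ⟨⟨θ, hθint⟩, rfl⟩
  have hθO : θ ^ d = (p : 𝓞 E) := RingOfIntegers.ext (by simpa using hθ)
  have h1 := pow_mul_natAbs_discr_pow_le hp hd.ne_zero _ hθO hfin hpF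
  have h2 := abs_discr_le_mulHeight₁_pow pb
  have h1' : (p : ℝ) ^ (finrank ℚ F * (d - 1)) * |(discr F : ℝ)| ^ d ≤ |(discr E : ℝ)| := by
    rw [← Int.cast_abs, ← Int.cast_abs, Int.abs_eq_natAbs, Int.abs_eq_natAbs]
    exact_mod_cast h1
  have hF : 0 < |(discr F : ℝ)| := abs_pos.2 (Int.cast_ne_zero.2 (discr_ne_zero F))
  have h3 : (p : ℝ) ^ (finrank ℚ F * (d - 1)) ≤
      mulHeight₁ pb.gen ^ (2 * (d - 1)) * (d : ℝ) ^ (d * finrank ℚ F) := by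
    refine le_of_mul_le_mul_right ?_ (pow_pos hF d)
    rw [hdim] at h2
    refine (h1'.trans h2).trans_eq ?_
    ring
  have hp0 : (0 : ℝ) < p := by exact_mod_cast hp.pos
  have hd0 : (0 : ℝ) < d := by exact_mod_cast hd.pos
  have hd1 : (0 : ℝ) < (d : ℝ) - 1 := by
    have : (1 : ℝ) < d := by exact_mod_cast hd.one_lt
    linarith
  have hH := mulHeight₁_pos pb.gen
  -- After taking logarithms, the claim follows on division by 2(d-1)[E:ℚ], where [E:ℚ] = d[F:ℚ].
  have h4 := Real.log_le_log (by positivity) h3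
  rw [Real.log_mul (by positivity) (by positivity), Real.log_pow, Real.log_pow, Real.log_pow,
    Nat.cast_mul, Nat.cast_mul, Nat.cast_mul, Nat.cast_sub hd.one_le, Nat.cast_one] at h4
  have hN : (0 : ℝ) < finrank ℚ F := by exact_mod_cast finrank_pos
  have hfinE : (finrank ℚ E : ℝ) = finrank ℚ F * d := by
    rw [← finrank_mul_finrank ℚ F E, hfin]; push_cast; rfl
  rw [hfinE, logHeight₁, sub_le_iff_le_add, div_add_div _ _ (by positivity) (by positivity),
    div_le_div_iff₀ (by positivity) (by positivity)]
  push_cast at h4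
  nlinarith [mul_le_mul_of_nonneg_left h4 (show (0 : ℝ) ≤ 2 * d by positivity)]

end PrimeDegree

/-! ### One step of the tower -/

section Layer

open Height Polynomial

variable {Ω : Type*} [Field Ω] [CharZero Ω]

theorem adjoin_inclusion_eq_top {S : Set Ω} {θ : Ω} {F E : IntermediateField ℚ Ω}
    (hF : F = IntermediateField.adjoin ℚ S) (hE : E = IntermediateField.adjoin ℚ (insert θ S))
    (h : F ≤ E) (hθ : θ ∈ E) :
    letI := (IntermediateField.inclusion h).toRingHom.toAlgebra
    IntermediateField.adjoin F {(⟨θ, hθ⟩ : E)} = ⊤ := by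
  subst hF hE
  let := (IntermediateField.inclusion h).toRingHom.toAlgebra
  refine eq_top_iff.2 fun x _ => ?_
  obtain ⟨x, hx⟩ := x
  induction hx using IntermediateField.adjoin_induction with
  | mem x hx =>
    rcases hx with rfl | hx
    · exact IntermediateField.mem_adjoin_simple_self _ _
    · exact IntermediateField.algebraMap_mem _
        (⟨x, IntermediateField.subset_adjoin ℚ S hx⟩ : IntermediateField.adjoin ℚ S)
  | algebraMap q =>
    exact IntermediateField.algebraMap_mem _ (algebraMap ℚ (IntermediateField.adjoin ℚ S) q)
  | add x y hx hy h1 h2 => exact add_mem (h1 trivial) (h2 trivial)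
  | mul x y hx hy h1 h2 => exact mul_mem (h1 trivial) (h2 trivial)
  | inv x hx h1 => exact inv_mem (h1 trivial)

/-- One layer of the tower: adjoining a root of the irreducible polynomial `X ^ d - p`. -/
theorem adjoin_insert_root {S : Set Ω} {θ : Ω} {F E : IntermediateField ℚ Ω}
    (hF : F = IntermediateField.adjoin ℚ S) (hE : E = IntermediateField.adjoin ℚ (insert θ S))
    [NumberField F] [NumberField E] {d p : ℕ} (hd : d.Prime) (hp : p.Prime)
    (hθ : θ ^ d = (p : Ω)) (hno : ∀ b ∈ F, b ^ d ≠ (p : Ω)) :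
    finrank ℚ E = finrank ℚ F * d ∧
      (∀ q : ℕ, q.Prime → (q : ℤ) ∣ discr E → (q : ℤ) ∣ discr F ∨ q = d ∨ q = p) ∧
      ∀ α ∈ E, α ∉ F → d ≤ finrank ℚ ℚ⟮α⟯ ∧ (¬ (p : ℤ) ∣ discr F →
          Real.log p / (2 * d) - Real.log d / (2 * (d - 1)) ≤ absLogHeight₁ α) := by
  have hle : F ≤ E := by
    rw [hF, hE]; exact IntermediateField.adjoin.mono _ _ _ (Set.subset_insert _ _)
  have hmem : θ ∈ E := by
    rw [hE]; exact IntermediateField.subset_adjoin _ _ (Set.mem_insert _ _)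
  let := (IntermediateField.inclusion hle).toRingHom.toAlgebra
  have : FiniteDimensional F E := FiniteDimensional.right ℚ F E
  have hgen := adjoin_inclusion_eq_top hF hE hle hmem
  let t : E := ⟨θ, hmem⟩
  have ht : t ^ d = (p : E) := Subtype.ext (by simpa [t] using hθ)
  have hirr : Irreducible (X ^ d - C (p : F)) := by
    refine X_pow_sub_C_irreducible_of_prime hd fun b hb => hno b b.2 ?_
    simpa using congrArg (Subtype.val) hb
  have hmin : minpoly F t = X ^ d - C (p : F) := by
    refine (minpoly.eq_of_irreducible_of_monic hirr ?_ (monic_X_pow_sub_C _ hd.ne_zero)).symm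
    simp [ht]
  have hfin : finrank F E = d := finrank_eq_of_minpoly hgen hmin
  have htint : IsIntegral ℤ t := by
    refine IsIntegral.of_pow hd.pos ?_
    rw [ht]
    simpa using isIntegral_algebraMap (R := ℤ) (A := E) (x := (p : ℤ))
  refine ⟨finrank_rat_eq_mul hfin, fun q hq hqE => ?_, fun α hαE hαF => ?_⟩
  · rcases prime_dvd_discr_adjoin_root hq hd.ne_zero (⟨t, htint⟩ : 𝓞 E) hgen hmin hqE with h | h | h
    · exact .inl h
    · exact .inr (.inl ((Nat.prime_dvd_prime_iff_eq hq hd).1 h))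
    · exact .inr (.inr ((Nat.prime_dvd_prime_iff_eq hq hp).1 h))
  · have hα : (⟨α, hαE⟩ : E) ∉ Set.range (algebraMap F E) := by
      rintro ⟨y, hy⟩
      exact hαF (by rw [show α = y from (congrArg Subtype.val hy).symm]; exact y.2)
    constructor
    · have hint : IsIntegral ℚ (⟨α, hαE⟩ : E) := Algebra.IsIntegral.isIntegral _
      have htop := adjoin_simple_eq_top_of_finrank_prime hd hfin hα
      have h1 := IntermediateField.adjoin.finrank
        (Algebra.IsIntegral.isIntegral (R := F) (⟨α, hαE⟩ : E))
      rw [htop, IntermediateField.finrank_top', hfin] at h1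
      have hintα : IsIntegral ℚ α := hint.map E.val
      have hminα : minpoly ℚ α = minpoly ℚ (⟨α, hαE⟩ : E) :=
        minpoly.algHom_eq E.val E.val.injective (⟨α, hαE⟩ : E)
      rw [IntermediateField.adjoin.finrank hintα, h1, hminα]
      -- The minimal polynomial over `F` has degree d and divides the one over ℚ.
      exact (natDegree_le_of_dvd (minpoly.dvd_map_of_isScalarTower ℚ F (⟨α, hαE⟩ : E))
        (Polynomial.map_ne_zero (minpoly.ne_zero hint))).trans (natDegree_map _).le
    · intro hpF
      rw [absLogHeight₁_eq E ⟨α, hαE⟩]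
      exact le_logHeight₁_div_finrank hp hd ht hfin hpF hα

end Layer

/-! ### Growth estimates -/

section Asymptotics

open Filter Real

theorem eventually_le_rpow_mul_sub (γ ε T : ℝ) (hγ1 : γ ≤ 1) (hε : 0 < ε) :
    ∀ᶠ x : ℝ in atTop, ∀ l : ℝ, x ^ (1 - γ + ε / 2) ≤ l →
      T ≤ x ^ γ * (l / (2 * x) - log x / (2 * (x - 1))) := by
  have hε2 : 0 < ε / 2 := by positivity
  -- The main term is at least x^(ε/2)/2 and the correction at most log x ≤ x^(ε/2)/4, which leaves
  -- x^(ε/2)/4 ≥ T.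
  have h1 := (isLittleO_log_rpow_atTop hε2).bound (show (0 : ℝ) < 1 / 4 by norm_num)
  have h2 := (tendsto_rpow_atTop hε2).eventually_ge_atTop (4 * T)
  filter_upwards [h1, h2, eventually_ge_atTop (2 : ℝ)] with x h1 h2 hx l hl
  have hx0 : 0 < x := by linarith
  have hlog : 0 ≤ log x := log_nonneg (by linarith)
  rw [norm_of_nonneg hlog, norm_of_nonneg (by positivity)] at h1
  have h3 : x ^ (ε / 2) / 2 ≤ x ^ γ * (l / (2 * x)) := by
    have : x ^ (ε / 2) * x = x ^ γ * x ^ (1 - γ + ε / 2) := by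
      rw [← rpow_add hx0, ← rpow_add_one hx0.ne']
      ring_nf
    rw [← mul_div_assoc, div_le_div_iff₀ (by norm_num) (by positivity)]
    have := mul_le_mul_of_nonneg_left hl (rpow_pos_of_pos hx0 γ).le
    nlinarith
  have h4 : x ^ γ * (log x / (2 * (x - 1))) ≤ log x := by
    have hγx : x ^ γ ≤ x := by
      simpa using rpow_le_rpow_of_exponent_le (by linarith : 1 ≤ x) hγ1
    have hx1 : 0 < x - 1 := by linarith
    rw [← mul_div_assoc, div_le_iff₀ (by positivity)]
    nlinarith
  rw [mul_sub]
  linarith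

theorem eventually_rpow_mul_div_lt (γ ε t : ℝ) (hγ1 : γ ≤ 1) (hε : 0 < ε) (ht : 0 < t) :
    ∀ᶠ x : ℝ in atTop, ∀ l : ℝ, l ≤ log 2 + x ^ (1 - γ + ε / 2) →
      x ^ (γ - ε) * (l / x) < t := by
  have h1 := (tendsto_rpow_neg_atTop (show 0 < 1 - γ + ε by linarith)).const_mul (log 2)
  have h2 := tendsto_rpow_neg_atTop (show 0 < ε / 2 by linarith)
  have h3 := h1.add h2
  rw [mul_zero, add_zero] at h3
  filter_upwards [h3.eventually_lt_const ht, eventually_gt_atTop (0 : ℝ)] with x h hx l hl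
  refine lt_of_le_of_lt ?_ h
  have e1 : x ^ (γ - ε) / x = x ^ (-(1 - γ + ε)) := by
    rw [← rpow_sub_one hx.ne']; ring_nf
  have e2 : x ^ (-(1 - γ + ε)) * x ^ (1 - γ + ε / 2) = x ^ (-(ε / 2)) := by
    rw [← rpow_add hx]; ring_nf
  calc x ^ (γ - ε) * (l / x) = x ^ (-(1 - γ + ε)) * l := by rw [← e1]; ring
    _ ≤ x ^ (-(1 - γ + ε)) * (log 2 + x ^ (1 - γ + ε / 2)) := by gcongr
    _ = _ := by rw [mul_add, e2]; ring

/-- Doubling gains the factor 2^e > 1, which eventually beats the slack log 2 allowed in log p_i;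
this keeps p_i distinct from earlier p_j. -/
theorem eventually_log_two_add_lt_rpow {e : ℝ} (he : 0 < e) :
    ∀ᶠ x : ℝ in atTop, ∀ y : ℝ, 0 ≤ y → 2 * y ≤ x → log 2 + y ^ e < x ^ e := by
  have h2 : (1 : ℝ) < 2 ^ e := one_lt_rpow (by norm_num) he
  have h := (tendsto_rpow_atTop he).eventually_gt_atTop (log 2 * 2 ^ e / (2 ^ e - 1))
  filter_upwards [h] with x hx y hy hxy
  have h3 : 2 ^ e * y ^ e ≤ x ^ e := by
    rw [← mul_rpow (by norm_num) hy]
    exact rpow_le_rpow (by positivity) hxy he.le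
  rw [div_lt_iff₀ (by linarith)] at hx
  nlinarith

theorem eventually_log_lt_rpow {e : ℝ} (he : 0 < e) : ∀ᶠ x : ℝ in atTop, log x < x ^ e := by
  have h1 := (isLittleO_log_rpow_atTop he).bound (show (0 : ℝ) < 1 / 2 by norm_num)
  filter_upwards [h1, eventually_gt_atTop (0 : ℝ)] with x h hx
  have := rpow_pos_of_pos hx e
  rw [norm_of_nonneg this.le] at h
  linarith [le_norm_self (log x)]

end Asymptotics

/-! ### Separation of the primes -/

section Sequences

variable {d p : ℕ → ℕ}

theorem strictMono_of_two_mul_le (hpos : ∀ i, 0 < d i) (hgrowth : ∀ i, 2 * d i ≤ d (i + 1)) :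
    StrictMono d :=
  strictMono_nat_of_lt_succ fun i => by have := hpos i; have := hgrowth i; omega

/-- Under the growth conditions, `p i` eventually differs from all earlier `d j` and `p j`. -/
theorem eventually_forall_lt_ne {e : ℝ} (he : 0 < e) (hd : ∀ i, 0 < d i)
    (hgrowth : ∀ i, 2 * d i ≤ d (i + 1)) (hlower : ∀ i, (d i : ℝ) ^ e ≤ Real.log (p i))
    (hupper : ∀ i, Real.log (p i) ≤ Real.log 2 + (d i : ℝ) ^ e) :
    ∀ᶠ i in Filter.atTop, ∀ j < i, p i ≠ d j ∧ p i ≠ p j := by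
  have hmono := strictMono_of_two_mul_le hd hgrowth
  have htend : Filter.Tendsto (fun i => (d i : ℝ)) Filter.atTop Filter.atTop :=
    tendsto_natCast_atTop_atTop.comp hmono.tendsto_atTop
  filter_upwards [htend.eventually (eventually_log_two_add_lt_rpow he),
    htend.eventually (eventually_log_lt_rpow he)] with i h1 h2 j hj
  have hdj : (0 : ℝ) < d j := by exact_mod_cast hd j
  refine ⟨fun h => ?_, fun h => ?_⟩
  · have h3 : Real.log (d j) ≤ Real.log (d i) :=
      Real.log_le_log hdj (by exact_mod_cast (hmono hj).le)
    have := hlower i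
    rw [h] at this
    linarith
  · have h3 : 2 * d j ≤ d i := (hgrowth j).trans (hmono.monotone hj)
    have h4 := h1 (d j) hdj.le (by exact_mod_cast h3)
    have h5 := hlower i
    rw [h] at h5
    linarith [hupper j]

end Sequences

instance isIntegral_QBar : Algebra.IsIntegral ℚ QBar := by
  convert! (AlgebraicClosure.isAlgebraic ℚ).isIntegral

/-! ### Degree and height of a radical -/

section Radicals

open Polynomial

/-- A rational root would be an integer, and a prime is not a proper power. -/
theorem irreducible_X_pow_sub_C_rat {d p : ℕ} (hd : d.Prime) (hp : p.Prime) :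
    Irreducible (X ^ d - C (p : ℚ)) := by
  refine X_pow_sub_C_irreducible_of_prime hd fun b hb => ?_
  obtain ⟨m, rfl⟩ : ∃ m : ℤ, (m : ℚ) = b := by
    refine IsIntegrallyClosed.exists_algebraMap_eq_of_isIntegral_pow (R := ℤ) hd.pos ?_
    rw [hb]
    simpa using isIntegral_algebraMap (R := ℤ) (A := ℚ) (x := (p : ℤ))
  have h : m ^ d = (p : ℤ) := by exact_mod_cast hb
  have hirr := (Nat.prime_iff_prime_int.1 hp).irreducible
  rw [← h] at hirr
  exact not_irreducible_pow hd.ne_one hirr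

theorem degree_eq_of_pow_eq {d p : ℕ} (hd : d.Prime) (hp : p.Prime) {b : QBar}
    (hb : b ^ d = (p : QBar)) : degree b = d := by
  have hmin : minpoly ℚ b = X ^ d - C (p : ℚ) := by
    refine (minpoly.eq_of_irreducible_of_monic (irreducible_X_pow_sub_C_rat hd hp) ?_
      (monic_X_pow_sub_C _ hd.ne_zero)).symm
    simp [hb]
  rw [degree, IntermediateField.adjoin.finrank (Algebra.IsIntegral.isIntegral b), hmin,
    natDegree_X_pow_sub_C]

theorem absLogHeight₁_eq_of_pow_eq {d p : ℕ} (hd : d ≠ 0) (hp : p ≠ 0) {b : QBar}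
    (hb : b ^ d = (p : QBar)) : absLogHeight₁ b = Real.log p / d := by
  have : FiniteDimensional ℚ ℚ⟮b⟯ :=
    IntermediateField.adjoin.finiteDimensional (Algebra.IsIntegral.isIntegral b)
  have : NumberField ℚ⟮b⟯ := {}
  have : NeZero p := ⟨hp⟩
  let t : ℚ⟮b⟯ := IntermediateField.AdjoinSimple.gen ℚ b
  have ht : t ^ d = algebraMap ℚ ℚ⟮b⟯ (p : ℚ) := Subtype.ext (by simpa [t] using hb)
  have h1 := Height.logHeight₁_pow t d
  rw [ht, logHeight₁_algebraMap, Rat.logHeight₁_natCast] at h1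
  have h2 : absLogHeight₁ b = _ := absLogHeight₁_eq ℚ⟮b⟯ t
  have hn : (finrank ℚ ℚ⟮b⟯ : ℝ) ≠ 0 := by exact_mod_cast finrank_pos.ne'
  have hd' : (d : ℝ) ≠ 0 := by exact_mod_cast hd
  rw [h2, div_eq_div_iff hn hd']
  linarith

end Radicals

/-! ### The tower of radical fields -/

section Tower

variable (θ : ℕ → QBar)

/-- The field generated by the first `i` of the radicals `θ 0, θ 1, …`. -/
noncomputable abbrev layer (i : ℕ) : IntermediateField ℚ QBar := IntermediateField.adjoin ℚ (θ '' Set.Iio i)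

instance numberField_layer (i : ℕ) : NumberField (layer θ i) := by
  have : Finite (θ '' Set.Iio i) := ((Set.finite_Iio i).image θ).to_subtype
  have : FiniteDimensional ℚ (layer θ i) :=
    IntermediateField.finiteDimensional_adjoin fun x _ => Algebra.IsIntegral.isIntegral x
  exact {}

theorem layer_mono : Monotone (layer θ) := fun _ _ h =>
  IntermediateField.adjoin.mono _ _ _ (Set.image_mono (Set.Iio_subset_Iio h))

theorem layer_zero : layer θ 0 = ⊥ := by
  simp [layer]

theorem layer_succ (i : ℕ) :
    layer θ (i + 1) = IntermediateField.adjoin ℚ (insert (θ i) (θ '' Set.Iio i)) := by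
  rw [layer, ← Set.image_insert_eq]
  congr 2
  ext j
  simp only [Set.mem_Iio, Set.mem_insert_iff]
  omega

theorem exists_mem_layer {α : QBar} (hα : α ∈ IntermediateField.adjoin ℚ (Set.range θ)) :
    ∃ m, α ∈ layer θ m := by
  induction hα using IntermediateField.adjoin_induction with
  | mem x hx =>
    obtain ⟨i, rfl⟩ := hx
    exact ⟨i + 1, IntermediateField.subset_adjoin _ _ ⟨i, Nat.lt_succ_self i, rfl⟩⟩
  | algebraMap q => exact ⟨0, IntermediateField.algebraMap_mem _ q⟩
  | add x y _ _ h1 h2 =>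
    obtain ⟨m, hm⟩ := h1
    obtain ⟨n, hn⟩ := h2
    exact ⟨max m n, add_mem (layer_mono θ (le_max_left m n) hm)
      (layer_mono θ (le_max_right m n) hn)⟩
  | mul x y _ _ h1 h2 =>
    obtain ⟨m, hm⟩ := h1
    obtain ⟨n, hn⟩ := h2
    exact ⟨max m n, mul_mem (layer_mono θ (le_max_left m n) hm)
      (layer_mono θ (le_max_right m n) hn)⟩
  | inv x _ h =>
    obtain ⟨m, hm⟩ := h
    exact ⟨m, inv_mem hm⟩

variable {θ} {d p : ℕ → ℕ} (hd : ∀ i, (d i).Prime) (hp : ∀ i, (p i).Prime)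
  (hinj : Function.Injective d) (hθ : ∀ i, θ i ^ d i = (p i : QBar))

/-- Every such root has degree d_i over ℚ, which would have to divide the degree of the layer. -/
theorem pow_ne_of_mem_layer {i : ℕ} (hdi : (d i).Prime) (hpi : (p i).Prime)
    (hfin : ¬ d i ∣ finrank ℚ (layer θ i)) : ∀ b ∈ layer θ i, b ^ d i ≠ (p i : QBar) := by
  intro b hb h
  refine hfin ?_
  nth_rewrite 1 [← degree_eq_of_pow_eq hdi hpi h]
  exact IntermediateField.finrank_dvd_of_le_right
    (IntermediateField.adjoin_simple_le_iff.2 hb)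

include hd hp hinj hθ

/-- The earlier d_j are primes different from d_i, so d_i does not divide the degree reached so far
and the next step has full degree. -/
theorem finrank_layer (i : ℕ) : finrank ℚ (layer θ i) = ∏ j ∈ Finset.range i, d j := by
  induction i with
  | zero => rw [Finset.prod_range_zero, IntermediateField.finrank_eq_one_iff, layer_zero]
  | succ i ih =>
    have hnd : ¬ d i ∣ finrank ℚ (layer θ i) := by
      rw [ih, (hd i).prime.dvd_finsetProd_iff]
      rintro ⟨j, hj, h⟩
      exact (Finset.mem_range.1 hj).ne' (hinj ((Nat.prime_dvd_prime_iff_eq (hd i) (hd j)).1 h))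
    rw [Finset.prod_range_succ, ← ih]
    exact (adjoin_insert_root rfl (layer_succ θ i) (hd i) (hp i) (hθ i)
      (pow_ne_of_mem_layer (hd i) (hp i) hnd)).1

theorem layer_pow_ne (i : ℕ) : ∀ b ∈ layer θ i, b ^ d i ≠ (p i : QBar) := by
  refine pow_ne_of_mem_layer (hd i) (hp i) ?_
  rw [finrank_layer hd hp hinj hθ, (hd i).prime.dvd_finsetProd_iff]
  rintro ⟨j, hj, h⟩
  exact (Finset.mem_range.1 hj).ne' (hinj ((Nat.prime_dvd_prime_iff_eq (hd i) (hd j)).1 h))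

theorem prime_dvd_discr_layer (i : ℕ) {q : ℕ} (hq : q.Prime)
    (h : (q : ℤ) ∣ discr (layer θ i)) : ∃ j < i, q = d j ∨ q = p j := by
  induction i with
  | zero =>
    have h1 : discr (layer θ 0) = 1 := by
      rw [← Rat.numberField_discr]
      exact discr_eq_discr_of_algEquiv _
        ((IntermediateField.equivOfEq (layer_zero θ)).trans (IntermediateField.botEquiv ℚ QBar))
    rw [h1] at h
    exact absurd (Int.natCast_dvd.1 h) (by simpa using hq.ne_one)
  | succ i ih =>
    rcases (adjoin_insert_root rfl (layer_succ θ i) (hd i) (hp i) (hθ i)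
      (layer_pow_ne hd hp hinj hθ i)).2.1 q hq h with h | h
    · obtain ⟨j, hj, hj'⟩ := ih h
      exact ⟨j, hj.trans (Nat.lt_succ_self i), hj'⟩
    · exact ⟨i, Nat.lt_succ_self i, h⟩

theorem height_bound_of_mem_layer_succ {i : ℕ} (hne : ∀ j < i, p i ≠ d j ∧ p i ≠ p j)
    {α : QBar} (hα : α ∈ layer θ (i + 1)) (hα' : α ∉ layer θ i) :
    d i ≤ degree α ∧
      Real.log (p i) / (2 * d i) - Real.log (d i) / (2 * (d i - 1)) ≤ absLogHeight₁ α := by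
  have h := (adjoin_insert_root rfl (layer_succ θ i) (hd i) (hp i) (hθ i)
    (layer_pow_ne hd hp hinj hθ i)).2.2 α hα hα'
  refine ⟨h.1, h.2 fun hdvd => ?_⟩
  obtain ⟨j, hj, hj' | hj'⟩ := prime_dvd_discr_layer hd hp hinj hθ i (hp i) hdvd
  · exact (hne j hj).1 hj'
  · exact (hne j hj).2 hj'

end Tower

/-! ### Northcott and Bogomolov criteria, and the conclusion -/

/-- Northcott's theorem in a fixed number field, for the weighted heights with `0 ≤ γ`. -/
theorem finite_setOf_weightedHeight_lt (F : IntermediateField ℚ QBar) [NumberField F] {γ : ℝ}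
    (hγ : 0 ≤ γ) (t : ℝ≥0) : {α : QBar | α ∈ F ∧ weightedHeight γ α < t}.Finite := by
  refine ((finite_setOfPred_logHeight₁_le (K := F) (t * finrank ℚ F)).image Subtype.val).subset ?_
  rintro α ⟨hαF, hα⟩
  refine ⟨⟨α, hαF⟩, ?_, rfl⟩
  have h1 : (degree α : ℝ) ^ γ * absLogHeight₁ α < t := hα
  have hint : IsIntegral ℚ α := Algebra.IsIntegral.isIntegral α
  have : FiniteDimensional ℚ ℚ⟮α⟯ := IntermediateField.adjoin.finiteDimensional hint
  have hdeg : (1 : ℝ) ≤ degree α := by exact_mod_cast (finrank_pos : 0 < finrank ℚ ℚ⟮α⟯)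
  have h2 : absLogHeight₁ α ≤ (degree α : ℝ) ^ γ * absLogHeight₁ α :=
    le_mul_of_one_le_left (absLogHeight_nonneg α) (Real.one_le_rpow hdeg hγ)
  have h3 : absLogHeight₁ α = _ := absLogHeight₁_eq F ⟨α, hαF⟩
  have hn : (0 : ℝ) < finrank ℚ F := by exact_mod_cast finrank_pos
  rw [h3] at h2
  have h4 := h2.trans (h3 ▸ h1).le
  rwa [div_le_iff₀ hn] at h4

theorem isGammaNorthcott_of_finite {γ : ℝ} {S : Set QBar}
    (h : ∀ t : ℝ≥0, {α : QBar | α ∈ S ∧ weightedHeight γ α < t}.Finite) :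
    IsGammaNorthcott γ S := by
  rw [IsGammaNorthcott, northcottNumber]
  have : {t : ℝ≥0 | {α : QBar | α ∈ S ∧ weightedHeight γ α < t}.Infinite} = ∅ :=
    Set.eq_empty_of_forall_notMem fun t ht => ht (h t)
  rw [this, Set.image_empty, sInf_empty]

theorem not_isGammaBogomolov_of_infinite {γ : ℝ} {S : Set QBar}
    (h : ∀ t : ℝ≥0, 0 < t →
      {α : QBar | α ∈ S \ rootsOfUnitySet ∧ weightedHeight γ α < t}.Infinite) :
    ¬ IsGammaBogomolov γ S := by
  rw [IsGammaBogomolov, not_lt, northcottNumber]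
  refine le_of_forall_gt fun c hc => ?_
  obtain ⟨t, ht0, htc⟩ := ENNReal.lt_iff_exists_nnreal_btwn.1 hc
  exact (sInf_le (Set.mem_image_of_mem _ (h t (by exact_mod_cast ht0)))).trans_lt htc

theorem notMem_rootsOfUnitySet_of_pow_eq {d p : ℕ} (hp : p.Prime) {b : QBar}
    (hb : b ^ d = (p : QBar)) : b ∉ rootsOfUnitySet := by
  rintro ⟨n, hn, h⟩
  have h1 : (p : QBar) ^ n = 1 := by rw [← hb, ← pow_mul, mul_comm, pow_mul, h, one_pow]
  have h2 : p ^ n = 1 := by exact_mod_cast h1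
  exact hp.ne_one ((Nat.pow_eq_one.1 h2).resolve_right hn.ne')

end NorthcottNumbers

open NorthcottNumbers in
theorem mainTheorem4 (γ ε : ℝ) (hγ0 : 0 ≤ γ) (hγ1 : γ ≤ 1) (hε : 0 < ε)
    (d p : ℕ → ℕ) (hd : ∀ i, (d i).Prime) (hp : ∀ i, (p i).Prime)
    (hgrowth : ∀ i, 2 * d i ≤ d (i + 1))
    (hlower : ∀ i, (d i : ℝ) ^ (1 - γ + ε / 2) ≤ Real.log (p i))
    (hupper : ∀ i, Real.log (p i) ≤ Real.log 2 + (d i : ℝ) ^ (1 - γ + ε / 2))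
    (θ : ℕ → NorthcottNumbers.QBar)
    (hθ : ∀ i, θ i ^ d i = (p i : NorthcottNumbers.QBar)) :
    NorthcottNumbers.IsGammaNorthcott γ
        (IntermediateField.adjoin ℚ (Set.range θ) : Set NorthcottNumbers.QBar) ∧
      ¬ NorthcottNumbers.IsGammaBogomolov (γ - ε)
        (IntermediateField.adjoin ℚ (Set.range θ) : Set NorthcottNumbers.QBar) := by
  have hmono := strictMono_of_two_mul_le (fun i => (hd i).pos) hgrowth
  have htend : Filter.Tendsto (fun i => (d i : ℝ)) Filter.atTop Filter.atTop :=
    tendsto_natCast_atTop_atTop.comp hmono.tendsto_atTop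
  constructor
  · refine isGammaNorthcott_of_finite fun t => ?_
    obtain ⟨i₀, hi₀⟩ := Filter.eventually_atTop.1
      ((eventually_forall_lt_ne (by linarith) (fun i => (hd i).pos) hgrowth hlower hupper).and
        (htend.eventually (eventually_le_rpow_mul_sub γ ε t hγ1 hε)))
    refine (finite_setOf_weightedHeight_lt (layer θ i₀) hγ0 t).subset ?_
    rintro α ⟨hα, hαt⟩
    refine ⟨?_, hαt⟩
    obtain ⟨m, hm⟩ := exists_mem_layer θ hα
    by_contra hα₀
    -- Some step beyond i₀ is where α enters the tower; the height bound at that step contradicts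
    -- h_γ(α) < t.
    have hstep : ∃ i, i₀ ≤ i ∧ α ∈ layer θ (i + 1) ∧ α ∉ layer θ i := by
      by_contra! hcon
      have hall (k : ℕ) : α ∉ layer θ (i₀ + k) := by
        induction k with
        | zero => exact hα₀
        | succ k ih => exact fun h => ih (hcon (i₀ + k) (Nat.le_add_right _ _) h)
      exact hall m (layer_mono θ (Nat.le_add_left m i₀) hm)
    obtain ⟨i, hi, hα1, hα2⟩ := hstep
    obtain ⟨hne, hT⟩ := hi₀ i hi
    obtain ⟨hdeg, hht⟩ := height_bound_of_mem_layer_succ hd hp hmono.injective hθ hne hα1 hα2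
    have hlt : (degree α : ℝ) ^ γ * NumberField.absLogHeight₁ α < t := hαt
    have h1 : (d i : ℝ) ^ γ * NumberField.absLogHeight₁ α ≤
        (degree α : ℝ) ^ γ * NumberField.absLogHeight₁ α :=
      mul_le_mul_of_nonneg_right
        (Real.rpow_le_rpow (Nat.cast_nonneg _) (by exact_mod_cast hdeg) hγ0)
        (absLogHeight_nonneg α)
    have h2 := mul_le_mul_of_nonneg_left hht (Real.rpow_nonneg (Nat.cast_nonneg (d i)) γ)
    linarith [hT _ (hlower i)]
  · refine not_isGammaBogomolov_of_infinite fun t ht => ?_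
    obtain ⟨i₀, hi₀⟩ := Filter.eventually_atTop.1
      (htend.eventually (eventually_rpow_mul_div_lt γ ε t hγ1 hε (by exact_mod_cast ht)))
    -- The degrees d_i tell the radicals apart, so a tail of the sequence is an infinite set.
    have hinj : Function.Injective θ := fun i j h => hmono.injective (by
      rw [← degree_eq_of_pow_eq (hd i) (hp i) (hθ i), h, degree_eq_of_pow_eq (hd j) (hp j) (hθ j)])
    refine ((Set.Ici_infinite i₀).image hinj.injOn).mono ?_
    rintro _ ⟨i, hi, rfl⟩
    refine ⟨⟨IntermediateField.subset_adjoin _ _ ⟨i, rfl⟩,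
      notMem_rootsOfUnitySet_of_pow_eq (hp i) (hθ i)⟩, ?_⟩
    change (degree (θ i) : ℝ) ^ (γ - ε) * NumberField.absLogHeight₁ (θ i) < t
    rw [degree_eq_of_pow_eq (hd i) (hp i) (hθ i),
      absLogHeight₁_eq_of_pow_eq (hd i).ne_zero (hp i).ne_zero (hθ i)]
    exact hi₀ i hi _ (hupper i)
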